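/- Let $K$ be a field, $n\ge 0$, and let $I\subset S=K[x_1,\dots,x_n]$ be a nonzero complete intersection monomial ideal, i.e. a nonzero ideal that is generated by monomials and that is generated by a regular sequence of $S$. Let $m$ be the number of elements of the minimal set of monomial generators of $I$. Then $$\operatorname{sdepth}(I)=n-\left\lfloor \frac m2\right\rfloor .$$ Here a Stanley decomposition of $I$ is a finite direct sum decomposition $\mathcal D:\ I=\bigoplus_{i=1}^r u_iK[Z_i]$ of $K$-vector spaces, where each $u_i\in I$ is a nonzero scalar multiple of a monomial (that is, a nonzero $\mathbb Z^n$-homogeneous element) and $Z_i\subseteq\{x_1,\dots,x_n\}$; its Stanley depth is $\operatorname{sdepth}(\mathcal D)=\min_i |Z_i|$; and $\operatorname{sdepth}(I)$ is the maximum of $\operatorname{sdepth}(\mathcal D)$ over all Stanley decompositions $\mathcal D$ of $I$. -/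

import Mathlib

/-- The ideal of `K[x₁, …, xₙ]` generated by the monomials with exponent vectors in `G`. -/
noncomputable def monomialSpan {n : ℕ} (K : Type*) [Field K] (G : Set (Fin n →₀ ℕ)) :
    Ideal (MvPolynomial (Fin n) K) :=
  Ideal.span ((fun a => MvPolynomial.monomial a (1 : K)) '' G)

/-- `I` is a monomial ideal: it is generated by monomials. -/
def IsMonomialIdeal {n : ℕ} {K : Type*} [Field K] (I : Ideal (MvPolynomial (Fin n) K)) : Prop :=
  ∃ G : Set (Fin n →₀ ℕ), I = monomialSpan K G

/-- `G` is (the set of exponent vectors of) a minimal set of monomial generators of `I`: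
it generates `I` and no proper subset of it does. -/
def IsMinimalMonomialGenerators {n : ℕ} {K : Type*} [Field K]
    (I : Ideal (MvPolynomial (Fin n) K)) (G : Finset (Fin n →₀ ℕ)) : Prop :=
  I = monomialSpan K (G : Set (Fin n →₀ ℕ)) ∧
    ∀ G' : Finset (Fin n →₀ ℕ), G' ⊂ G → I ≠ monomialSpan K (G' : Set (Fin n →₀ ℕ))

/-- `I` is a complete intersection: it is generated by a regular sequence. -/
def IsCompleteIntersectionIdeal {R : Type*} [CommRing R] (I : Ideal R) : Prop :=
  ∃ rs : List R, RingTheory.Sequence.IsRegular R rs ∧ Ideal.ofList rs = I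

/-- The `K`-subspace `u K[Z]` of `K[x₁, …, xₙ]`. -/
noncomputable def stanleySpace {n : ℕ} {K : Type*} [Field K]
    (u : MvPolynomial (Fin n) K) (Z : Finset (Fin n)) : Submodule K (MvPolynomial (Fin n) K) :=
  (Subalgebra.toSubmodule (MvPolynomial.supported K (Z : Set (Fin n)))).map
    (LinearMap.mulLeft K u)

/-- A Stanley decomposition `I = ⨁ᵢ uᵢ K[Zᵢ]` (a finite direct sum) of an ideal `I` of
`K[x₁, …, xₙ]`, where each `uᵢ` is a nonzero element of `I` that is homogeneous for the
`ℤⁿ`-grading, that is, a nonzero scalar multiple of a monomial. -/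
structure StanleyDecomposition {n : ℕ} {K : Type*} [Field K]
    (I : Ideal (MvPolynomial (Fin n) K)) where
  /-- the number of summands -/
  r : ℕ
  /-- the homogeneous elements -/
  u : Fin r → MvPolynomial (Fin n) K
  /-- the sets of variables -/
  Z : Fin r → Finset (Fin n)
  u_mem : ∀ i, u i ∈ I
  u_homogeneous : ∀ i, ∃ (a : Fin n →₀ ℕ) (c : K), c ≠ 0 ∧ u i = MvPolynomial.monomial a c
  independent : iSupIndep fun i => stanleySpace (u i) (Z i)
  iSup_eq : ⨆ i, stanleySpace (u i) (Z i) = I.restrictScalars K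

/-- The Stanley depth of a decomposition: the minimum of the `|Zᵢ|`
(`⊤` for the empty decomposition of the zero ideal). -/
noncomputable def StanleyDecomposition.sdepth {n : ℕ} {K : Type*} [Field K]
    {I : Ideal (MvPolynomial (Fin n) K)} (D : StanleyDecomposition I) : ℕ∞ :=
  ⨅ i, ((D.Z i).card : ℕ∞)

/-- The Stanley depth of `I`: the maximum of the Stanley depths of its Stanley decompositions. -/
noncomputable def stanleyDepth {n : ℕ} {K : Type*} [Field K]
    (I : Ideal (MvPolynomial (Fin n) K)) : ℕ∞ :=
  ⨆ D : StanleyDecomposition I, D.sdepth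

/-!
The proof has an algebraic, a geometric and a combinatorial part.

*Algebra.* The linear relations among the members of a regular sequence have coefficients in the
ideal `I` it generates. This property passes to the minimal monomial generators `G`
(`mem_of_sum_mul_eq_zero_of_span_eq`): modulo `I`, the transition matrices between the two systems
of generators are inverse to each other, and they are square because the relations among minimal
monomial generators have no constant terms. If two minimal generators had a variable in common,
the relation given by their least common multiple would put a proper divisor of one of them into
`I`. So the members of `G` have pairwise disjoint supports
(`IsMinimalMonomialGenerators.disjoint_support`).

*Geometry.* The space `x^u K[Z]` is spanned by the monomials whose exponents lie in a cone of
dimension `|Z|`, so Stanley decompositions of `I` amount to partitions of the set of exponents of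
`I` into cones.

*Upper bound.* In such a partition every `g ∈ G` is the vertex of a cone. If all cones had
dimension more than `n - ⌊m / 2⌋`, then each of these `m` cones would contain the product of `g`
with more than `(m - 1) / 2` other generators; there are too few pairs of generators for that
(`StanleyDecomposition.exists_card_le`).

*Lower bound.* It suffices to partition the nonempty subsets of an `m`-element set into intervals
`[A, B]` such that `B` misses at most `⌊m / 2⌋` elements: the monomials whose set of divisors in
`G` lies in `[A, B]` are the multiples of all `g ∈ A` which are not multiples of any `g ∉ B`, and
the latter conditions cost one dimension each (`isDisjointUnionOfCones_not_le`). For the interval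
partition, place the elements on a cycle `ℤ/N` of odd length `N = 2⌊m / 2⌋ + 1`. A nonempty
`T ⊆ ℤ/N` determines the set `E` of points at even distance after the last preceding point of `T`.
No two consecutive points are missing from `E`, so that at most half of the points are missing, and
the sets `T` with a given `E` are those with `E ∩ (E + 1) ⊆ T ⊆ E` (`isEvenHull_iff`,
`exists_isEvenHull`, `IsEvenHull.unique`). The length is odd in order that the empty set lies in
none of these intervals (`not_isEvenHull_empty`).
-/

/-! ### Relations among generators of an ideal -/

/-- Every linear relation among the members of a sequence `r`, each of which is a nonzerodivisor
modulo the previous ones, has its coefficients in the ideal generated by the sequence. -/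
theorem mem_span_of_sum_mul_eq_zero {R : Type*} [CommRing R] (r : ℕ → R) (N : ℕ)
    (hreg : ∀ k < N, ∀ x, r k * x ∈ Ideal.span (r '' (Finset.range k : Set ℕ)) →
      x ∈ Ideal.span (r '' (Finset.range k : Set ℕ)))
    (c : ℕ → R) (hc : ∑ i ∈ Finset.range N, c i * r i = 0) :
    ∀ i < N, c i ∈ Ideal.span (r '' (Finset.range N : Set ℕ)) := by
  induction N generalizing c with
  | zero => intro i hi; omega
  | succ k ih =>
    have hmono : Ideal.span (r '' (Finset.range k : Set ℕ)) ≤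
        Ideal.span (r '' (Finset.range (k + 1) : Set ℕ)) := by
      apply Ideal.span_mono
      apply Set.image_mono
      exact_mod_cast Finset.range_subset_range.2 (Nat.le_succ k)
    have hrk : r k ∈ Ideal.span (r '' (Finset.range (k + 1) : Set ℕ)) :=
      Ideal.subset_span ⟨k, by simp, rfl⟩
    rw [Finset.sum_range_succ] at hc
    have hck : c k ∈ Ideal.span (r '' (Finset.range k : Set ℕ)) := by
      apply hreg k (Nat.lt_succ_self k)
      have : r k * c k = -∑ i ∈ Finset.range k, c i * r i := by linear_combination hc
      rw [this]
      refine neg_mem (Ideal.sum_mem _ fun i hi => Ideal.mul_mem_left _ _ ?_)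
      exact Ideal.subset_span ⟨i, by simpa using hi, rfl⟩
    obtain ⟨b, hb⟩ : ∃ b : ℕ → R, ∑ i ∈ Finset.range k, b i * r i = c k := by
      obtain ⟨b, hb⟩ := (Submodule.mem_span_image_finset_iff_exists_fun R).1 hck
      refine ⟨fun i => if hi : i ∈ Finset.range k then b ⟨i, hi⟩ else 0, ?_⟩
      rw [← hb, ← Finset.sum_coe_sort]
      exact Finset.sum_congr rfl fun i _ => by simp only [dif_pos i.2, smul_eq_mul]
    have hsum : ∑ i ∈ Finset.range k, (c i + b i * r k) * r i = 0 := by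
      rw [← hb, Finset.sum_mul] at hc
      rw [← hc, ← Finset.sum_add_distrib]
      exact Finset.sum_congr rfl fun i _ => by ring
    intro i hi
    rcases Nat.lt_succ_iff_lt_or_eq.1 hi with hi | rfl
    · have h := hmono (ih (fun j hj => hreg j (by omega)) (fun i => c i + b i * r k) hsum i hi)
      simpa using sub_mem h (Ideal.mul_mem_left _ (b i) hrk)
    · exact hmono hck

/-- The linear relations among the members of a weakly regular sequence have their coefficients in
the ideal that the sequence generates. -/
theorem RingTheory.Sequence.IsWeaklyRegular.mem_ofList_of_sum_mul_eq_zero {R : Type*} [CommRing R]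
    {rs : List R} (h : RingTheory.Sequence.IsWeaklyRegular R rs) (c : Fin rs.length → R)
    (hc : ∑ i, c i * rs[i] = 0) (i : Fin rs.length) : c i ∈ Ideal.ofList rs := by
  have hspan : ∀ k ≤ rs.length, Ideal.span ((fun i => rs.getD i 0) '' (Finset.range k : Set ℕ)) =
      Ideal.ofList (rs.take k) := by
    intro k hk
    unfold Ideal.ofList
    congr 1
    ext x
    simp only [Set.mem_image, Finset.coe_range, Set.mem_Iio, Set.mem_ofPred_eq,
      List.mem_take_iff_getElem]
    constructor
    · rintro ⟨j, hj, rfl⟩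
      exact ⟨j, by omega, by rw [List.getD_eq_getElem]⟩
    · rintro ⟨j, hj, rfl⟩
      exact ⟨j, by omega, by rw [List.getD_eq_getElem]⟩
  have key := mem_span_of_sum_mul_eq_zero (fun i => rs.getD i 0) rs.length ?_
    (fun i => if hi : i < rs.length then c ⟨i, hi⟩ else 0) ?_ i i.2
  · rw [hspan _ le_rfl, List.take_length] at key
    simpa using key
  · intro k hk x hx
    rw [hspan k hk.le] at hx ⊢
    have hr := h.regular_mod_prev k hk
    rw [isSMulRegular_iff_right_eq_zero_of_smul] at hr
    have := hr (Submodule.Quotient.mk x) (by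
      rw [← Submodule.Quotient.mk_smul, Submodule.Quotient.mk_eq_zero]
      simpa [hk] using hx)
    rw [Submodule.Quotient.mk_eq_zero] at this
    simpa using this
  · rw [Finset.sum_range]
    simpa using hc

theorem Matrix.map_quotientMk_eq_one {R α : Type*} [CommRing R] [DecidableEq α] {J : Ideal R}
    {X : Matrix α α R} (hX : ∀ k l, (X - 1 : Matrix α α R) k l ∈ J) :
    X.map (Ideal.Quotient.mk J) = 1 := by
  rw [← sub_eq_zero, ← Matrix.map_one (Ideal.Quotient.mk J) (map_zero _) (map_one _),
    ← Matrix.map_sub _ (map_sub _)]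
  ext k l
  exact Ideal.Quotient.eq_zero_iff_mem.2 (hX k l)

/-- Let two finite families `r` and `g` generate the same ideal `I`. If the relations among the
members of `r` have coefficients in `I`, and those among the members of `g` have coefficients in
some proper ideal containing `I`, then the relations among the members of `g` have coefficients
in `I`. Indeed the transition matrices are inverse to each other on one side modulo `I` and
on the other side modulo the larger ideal; hence they are square, and inverse to each other
modulo `I` on both sides. -/
theorem mem_of_sum_mul_eq_zero_of_span_eq {R ι κ : Type*} [CommRing R] [Fintype ι] [Fintype κ]
    {I M : Ideal R} (hIM : I ≤ M) (hM : M ≠ ⊤) (r : κ → R) (g : ι → R)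
    (hr : Ideal.span (Set.range r) = I) (hg : Ideal.span (Set.range g) = I)
    (hrI : ∀ c : κ → R, ∑ i, c i * r i = 0 → ∀ i, c i ∈ I)
    (hgM : ∀ c : ι → R, ∑ i, c i * g i = 0 → ∀ i, c i ∈ M)
    (c : ι → R) (hc : ∑ i, c i * g i = 0) (i : ι) : c i ∈ I := by
  classical
  have hA : ∀ k, ∃ a : ι → R, ∑ i, a i * g i = r k := fun k =>
    Ideal.mem_span_range_iff_exists_fun.1 (hg ▸ hr ▸ Ideal.subset_span ⟨k, rfl⟩)
  have hB : ∀ i, ∃ b : κ → R, ∑ k, b k * r k = g i := fun i =>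
    Ideal.mem_span_range_iff_exists_fun.1 (hr ▸ hg ▸ Ideal.subset_span ⟨i, rfl⟩)
  choose A hA using hA
  choose B hB using hB
  let A' : Matrix κ ι R := Matrix.of A
  let B' : Matrix ι κ R := Matrix.of B
  have hA' : A'.mulVec g = r := by ext k; simpa [Matrix.mulVec, dotProduct, A'] using hA k
  have hB' : B'.mulVec r = g := by ext k; simpa [Matrix.mulVec, dotProduct, B'] using hB k
  have hAB : ∀ k l, (A' * B' - 1 : Matrix κ κ R) k l ∈ I := fun k => hrI _ (by
    have : ((A' * B' - 1 : Matrix κ κ R).mulVec r) k = 0 := by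
      rw [Matrix.sub_mulVec, ← Matrix.mulVec_mulVec, hB', hA']; simp
    simpa [Matrix.mulVec, dotProduct] using this)
  have hBA : ∀ k l, (B' * A' - 1 : Matrix ι ι R) k l ∈ M := fun k => hgM _ (by
    have : ((B' * A' - 1 : Matrix ι ι R).mulVec g) k = 0 := by
      rw [Matrix.sub_mulVec, ← Matrix.mulVec_mulVec, hA', hB']; simp
    simpa [Matrix.mulVec, dotProduct] using this)
  have hcard : Fintype.card κ = Fintype.card ι := by
    have : Nontrivial (R ⧸ M) := Ideal.Quotient.nontrivial_iff.2 hM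
    apply Matrix.square_of_invertible (A'.map (Ideal.Quotient.mk M))
      (B'.map (Ideal.Quotient.mk M))
    · rw [← Matrix.map_mul]; exact Matrix.map_quotientMk_eq_one fun k l => hIM (hAB k l)
    · rw [← Matrix.map_mul]; exact Matrix.map_quotientMk_eq_one hBA
  have hBA' : B'.map (Ideal.Quotient.mk I) * A'.map (Ideal.Quotient.mk I) = 1 := by
    rw [Matrix.mul_eq_one_comm_of_card_eq _ _ _ hcard.symm, ← Matrix.map_mul]
    exact Matrix.map_quotientMk_eq_one hAB
  have hcB : ∀ k, (Matrix.vecMul c B') k ∈ I := hrI _ (by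
    have : Matrix.vecMul c B' ⬝ᵥ r = 0 := by
      rw [← Matrix.dotProduct_mulVec, hB']; simpa [dotProduct] using hc
    simpa [dotProduct] using this)
  have hzero : Matrix.vecMul (Ideal.Quotient.mk I ∘ c) (B'.map (Ideal.Quotient.mk I)) = 0 := by
    ext k
    rw [← RingHom.map_vecMul]
    exact Ideal.Quotient.eq_zero_iff_mem.2 (hcB k)
  have : Ideal.Quotient.mk I ∘ c = 0 := by
    rw [← Matrix.vecMul_one (Ideal.Quotient.mk I ∘ c), ← hBA', ← Matrix.vecMul_vecMul, hzero,
      Matrix.zero_vecMul]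
  exact Ideal.Quotient.eq_zero_iff_mem.1 (congrFun this i)

/-! ### Minimal monomial generators of a complete intersection -/

/-- A polynomial lies in the ideal generated by the monomials with exponents in `G` if and only if
each exponent of its support dominates an element of `G`. -/
theorem mem_monomialSpan {n : ℕ} {K : Type*} [Field K] {G : Set (Fin n →₀ ℕ)}
    {p : MvPolynomial (Fin n) K} :
    p ∈ monomialSpan K G ↔ ∀ b ∈ p.support, ∃ g ∈ G, g ≤ b :=
  MvPolynomial.mem_ideal_span_monomial_image

theorem monomial_mem_monomialSpan {n : ℕ} {K : Type*} [Field K] {G : Set (Fin n →₀ ℕ)}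
    {b : Fin n →₀ ℕ} {c : K} (hc : c ≠ 0) :
    MvPolynomial.monomial b c ∈ monomialSpan K G ↔ ∃ g ∈ G, g ≤ b := by
  classical
  rw [mem_monomialSpan, MvPolynomial.support_monomial, if_neg hc]
  simp

/-- Minimal monomial generators do not divide each other. -/
theorem IsMinimalMonomialGenerators.eq_of_le {n : ℕ} {K : Type*} [Field K]
    {I : Ideal (MvPolynomial (Fin n) K)} {G : Finset (Fin n →₀ ℕ)}
    (hG : IsMinimalMonomialGenerators I G) {g h : Fin n →₀ ℕ} (hg : g ∈ G) (hh : h ∈ G)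
    (hle : g ≤ h) : g = h := by
  classical
  by_contra hne
  refine hG.2 (G.erase h) (Finset.erase_ssubset hh) ?_
  rw [hG.1]
  ext p
  rw [mem_monomialSpan, mem_monomialSpan]
  refine forall₂_congr fun b _ => ⟨?_, ?_⟩
  · rintro ⟨f, hf, hfb⟩
    by_cases hfh : f = h
    · exact ⟨g, by simpa using ⟨hg, hne⟩, hle.trans (hfh ▸ hfb)⟩
    · exact ⟨f, by simpa using ⟨hf, hfh⟩, hfb⟩
  · rintro ⟨f, hf, hfb⟩
    exact ⟨f, Finset.mem_of_mem_erase hf, hfb⟩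

/-- A linear relation among monomials that do not divide each other has coefficients without
constant term. -/
theorem constantCoeff_eq_zero_of_sum_mul_monomial_eq_zero {n : ℕ} {K : Type*} [Field K]
    {G : Finset (Fin n →₀ ℕ)} (hG : ∀ g ∈ G, ∀ h ∈ G, g ≤ h → g = h)
    (c : G → MvPolynomial (Fin n) K)
    (hc : ∑ g, c g * MvPolynomial.monomial (g : Fin n →₀ ℕ) 1 = 0) (h : G) :
    MvPolynomial.constantCoeff (c h) = 0 := by
  have := congrArg (MvPolynomial.coeff (h : Fin n →₀ ℕ)) hc
  rw [MvPolynomial.coeff_sum, Finset.sum_eq_single h, MvPolynomial.coeff_mul_monomial'] at this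
  · simpa [MvPolynomial.constantCoeff_eq] using this
  · intro g _ hgh
    rw [MvPolynomial.coeff_mul_monomial', if_neg]
    exact fun hle => hgh (Subtype.ext (hG g g.2 h h.2 hle))
  · simp

/-- The minimal monomial generators of a complete intersection have pairwise disjoint supports. -/
theorem IsMinimalMonomialGenerators.disjoint_support {n : ℕ} {K : Type*} [Field K]
    {I : Ideal (MvPolynomial (Fin n) K)} {G : Finset (Fin n →₀ ℕ)}
    (hG : IsMinimalMonomialGenerators I G) (hci : IsCompleteIntersectionIdeal I)
    {g h : Fin n →₀ ℕ} (hg : g ∈ G) (hh : h ∈ G) (hne : g ≠ h) :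
    Disjoint g.support h.support := by
  classical
  obtain ⟨rs, hrs, hrsI⟩ := hci
  have htop : I ≠ ⊤ := by
    rintro rfl
    exact hrs.top_ne_smul (by simp [hrsI])
  have hanti : ∀ g ∈ G, ∀ h ∈ G, g ≤ h → g = h := fun g hg h hh => hG.eq_of_le hg hh
  have hIM : I ≤ RingHom.ker (MvPolynomial.constantCoeff (σ := Fin n) (R := K)) := by
    intro p hp
    rw [RingHom.mem_ker, MvPolynomial.constantCoeff_eq]
    by_contra h0
    rw [hG.1, mem_monomialSpan] at hp
    obtain ⟨f, hf, hf0⟩ := hp 0 (MvPolynomial.mem_support_iff.2 h0)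
    refine htop ((Ideal.eq_top_iff_one _).2 ?_)
    rw [hG.1]
    exact (monomial_mem_monomialSpan one_ne_zero).2 ⟨f, hf, hf0⟩
  by_contra hdis
  obtain ⟨i, hi, hi'⟩ := Finset.not_disjoint_iff.1 hdis
  rw [Finsupp.mem_support_iff] at hi hi'
  -- The relation between the two monomials given by their least common multiple.
  let c : G → MvPolynomial (Fin n) K := fun f =>
    if f = ⟨g, hg⟩ then MvPolynomial.monomial (h - g ⊓ h) 1
    else if f = ⟨h, hh⟩ then - MvPolynomial.monomial (g - g ⊓ h) 1 else 0
  have key := mem_of_sum_mul_eq_zero_of_span_eq hIM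
    (RingHom.ker_ne_top _) (fun k : Fin rs.length => rs[k])
    (fun f : G => MvPolynomial.monomial (f : Fin n →₀ ℕ) (1 : K)) ?_ ?_ ?_ ?_ c ?_ ⟨g, hg⟩
  · rw [hG.1] at key
    simp only [c, if_pos] at key
    obtain ⟨f, hf, hfle⟩ := (monomial_mem_monomialSpan one_ne_zero).1 key
    obtain rfl := hanti f hf h hh (hfle.trans tsub_le_self)
    have := hfle i
    simp only [Finsupp.coe_tsub, Pi.sub_apply, Finsupp.inf_apply] at this
    omega
  · rw [← hrsI]
    unfold Ideal.ofList
    congr 1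
    ext x
    simp [List.mem_iff_getElem, Fin.exists_iff]
  · rw [hG.1]
    unfold monomialSpan
    congr 1
    ext x
    simp
  · intro c hc k
    rw [← hrsI]
    exact hrs.toIsWeaklyRegular.mem_ofList_of_sum_mul_eq_zero c hc k
  · exact fun c hc f => constantCoeff_eq_zero_of_sum_mul_monomial_eq_zero hanti c hc f
  · have hgh : (⟨h, hh⟩ : G) ≠ ⟨g, hg⟩ := fun e => hne (Subtype.ext_iff.1 e).symm
    rw [Finset.sum_eq_add ⟨g, hg⟩ ⟨h, hh⟩ hgh.symm]
    · simp only [c, if_pos, if_neg hgh, neg_mul, MvPolynomial.monomial_mul, mul_one]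
      rw [← sub_eq_add_neg, sub_eq_zero]
      refine congrArg (fun a => MvPolynomial.monomial a (1 : K)) ?_
      ext j
      simp only [Finsupp.coe_add, Finsupp.coe_tsub, Pi.add_apply, Pi.sub_apply, Finsupp.inf_apply]
      omega
    · intro f _ hf
      simp [c, hf.1, hf.2]
    · simp
    · simp

/-! ### Interval partitions of the nonempty subsets of a cycle -/

/-- The subset `E` of the cycle `ℤ/N` consists of the points at even distance from the last point
of `T` that is at or before them. This is encoded by the recursion along the cycle, which determines
`E` when `T` is nonempty. -/
def IsEvenHull {N : ℕ} (T E : Finset (ZMod N)) : Prop :=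
  ∀ x, x ∈ E ↔ x ∈ T ∨ x - 1 ∉ E

/-- The recursion says that `E` omits no two consecutive points and that `E ∩ (E + 1) ⊆ T ⊆ E`.
So the sets `T` with a given `E` form an interval. -/
theorem isEvenHull_iff {N : ℕ} {T E : Finset (ZMod N)} :
    IsEvenHull T E ↔ (∀ x, x ∉ E → x - 1 ∈ E) ∧ (∀ x, x ∈ E → x - 1 ∈ E → x ∈ T) ∧
      ∀ x, x ∉ E → x ∉ T := by
  unfold IsEvenHull
  rw [← forall_and, ← forall_and]
  exact forall_congr' fun x => by tauto

theorem exists_isEvenHull {N : ℕ} [NeZero N] {T : Finset (ZMod N)} (hT : T.Nonempty) :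
    ∃ E, IsEvenHull T E := by
  classical
  obtain ⟨t, ht⟩ := hT
  -- Walk once around the cycle, starting from a point of `T`.
  let e : ℕ → Prop := fun i =>
    Nat.rec (motive := fun _ => Prop) True (fun j p => t + (j + 1 : ℕ) ∈ T ∨ ¬p) i
  refine ⟨Finset.univ.filter fun x : ZMod N => e (x - t).val, fun x => ?_⟩
  simp only [Finset.mem_filter, Finset.mem_univ, true_and]
  rcases hi : (x - t).val with _ | j
  · have hx : x = t := by rwa [ZMod.val_eq_zero, sub_eq_zero] at hi
    subst hx
    exact ⟨fun _ => Or.inl ht, fun _ => trivial⟩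
  · have hx : x - t = ((j + 1 : ℕ) : ZMod N) := by rw [← hi, ZMod.natCast_zmod_val]
    have hj : (x - 1 - t).val = j := by
      have : x - 1 - t = (j : ZMod N) := by
        push_cast at hx
        linear_combination hx
      rw [this, ZMod.val_natCast_of_lt]
      have := ZMod.val_lt (x - t)
      omega
    have hx' : x = t + ((j + 1 : ℕ) : ZMod N) := by linear_combination hx
    rw [hj]
    conv_rhs => rw [hx']

theorem IsEvenHull.unique {N : ℕ} [NeZero N] {T E F : Finset (ZMod N)} (hT : T.Nonempty)
    (hE : IsEvenHull T E) (hF : IsEvenHull T F) : E = F := by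
  obtain ⟨t, ht⟩ := hT
  have h : ∀ i : ℕ, t + i ∈ E ↔ t + i ∈ F := by
    intro i
    induction i with
    | zero => simp [(hE t).2 (Or.inl ht), (hF t).2 (Or.inl ht)]
    | succ j ih =>
      have hj : t + ((j + 1 : ℕ) : ZMod N) - 1 = t + j := by push_cast; ring
      rw [hE, hF, hj, ih]
  ext x
  have := h (x - t).val
  rwa [ZMod.natCast_zmod_val, add_sub_cancel] at this

/-- On a cycle of odd length the points cannot alternately belong and not belong to a set. -/
theorem not_isEvenHull_empty {N : ℕ} (hN : Odd N) (E : Finset (ZMod N)) : ¬ IsEvenHull ∅ E := by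
  intro hE
  have h : ∀ i : ℕ, (i : ZMod N) ∈ E ↔ (Even i ↔ (0 : ZMod N) ∈ E) := by
    intro i
    induction i with
    | zero => simp
    | succ j ih =>
      have hj : ((j + 1 : ℕ) : ZMod N) - 1 = j := by push_cast; ring
      rw [hE, hj, ih, Nat.even_add_one]
      simp only [Finset.notMem_empty, false_or]
      tauto
  have := h N
  rw [ZMod.natCast_self, ← Nat.not_odd_iff_even] at this
  tauto

/-- Since no two consecutive points are missing, at most half of the points are. -/
theorem IsEvenHull.two_mul_card_compl_le {N : ℕ} [NeZero N] {T E : Finset (ZMod N)}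
    (hE : IsEvenHull T E) : 2 * Eᶜ.card ≤ N := by
  have h : Eᶜ.card ≤ E.card := by
    refine Finset.card_le_card_of_injOn (fun x => x - 1) ?_ (sub_left_injective.injOn)
    intro x hx
    exact (isEvenHull_iff.1 hE).1 x (by simpa using hx)
  have := Finset.card_compl_add_card E
  rw [ZMod.card] at this
  omega

/-! ### Stanley spaces and cones of exponent vectors -/

/-- The exponent vectors of the monomials in the Stanley space `x^u K[Z]`. -/
def exponentCone {n : ℕ} (u : Fin n →₀ ℕ) (Z : Finset (Fin n)) : Set (Fin n →₀ ℕ) :=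
  {a | u ≤ a ∧ ∀ i ∉ Z, a i = u i}

theorem self_mem_exponentCone {n : ℕ} (u : Fin n →₀ ℕ) (Z : Finset (Fin n)) :
    u ∈ exponentCone u Z :=
  ⟨le_rfl, fun _ _ => rfl⟩

/-- The exponents dominating an element of `G`: those of the monomials in `monomialSpan K G`. -/
def upperExponents {n : ℕ} (G : Finset (Fin n →₀ ℕ)) : Set (Fin n →₀ ℕ) :=
  {a | ∃ g ∈ G, g ≤ a}

theorem stanleySpace_monomial {n : ℕ} {K : Type*} [Field K] (u : Fin n →₀ ℕ) {c : K} (hc : c ≠ 0)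
    (Z : Finset (Fin n)) :
    stanleySpace (MvPolynomial.monomial u c) Z =
      MvPolynomial.restrictSupport K (exponentCone u Z) := by
  classical
  apply le_antisymm
  · rintro _ ⟨q, hq, rfl⟩
    have hq' : ↑q.vars ⊆ (Z : Set (Fin n)) := MvPolynomial.mem_supported.1 hq
    rw [MvPolynomial.mem_restrictSupport_iff]
    intro b hb
    simp only [LinearMap.mulLeft_apply, Finset.mem_coe, MvPolynomial.mem_support_iff,
      MvPolynomial.coeff_monomial_mul'] at hb
    by_cases hub : u ≤ b
    · rw [if_pos hub] at hb
      refine ⟨hub, fun i hi => ?_⟩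
      by_contra hne
      have hbi : u i ≤ b i := hub i
      refine hi (hq' (MvPolynomial.mem_vars_iff_mem_support i |>.2
        ⟨b - u, MvPolynomial.mem_support_iff.2 (right_ne_zero_of_mul hb), ?_⟩))
      rw [Finsupp.mem_support_iff, Finsupp.tsub_apply]
      omega
    · simp [hub] at hb
  · rw [MvPolynomial.restrictSupport_eq_span, Submodule.span_le]
    rintro _ ⟨b, ⟨hub, hb⟩, rfl⟩
    refine ⟨MvPolynomial.monomial (b - u) c⁻¹, ?_, ?_⟩
    · refine MvPolynomial.mem_supported.2 fun i hi => ?_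
      rw [MvPolynomial.vars_monomial (inv_ne_zero hc), Finset.mem_coe, Finsupp.mem_support_iff,
        Finsupp.tsub_apply] at hi
      by_contra hiZ
      exact hi (by rw [hb i hiZ, tsub_self])
    · simp [MvPolynomial.monomial_mul, hc, add_tsub_cancel_of_le hub]

theorem restrictSupport_iUnion {σ K : Type*} {ι : Sort*} [Field K] (s : ι → Set (σ →₀ ℕ)) :
    MvPolynomial.restrictSupport K (⋃ i, s i) = ⨆ i, MvPolynomial.restrictSupport K (s i) := by
  simp_rw [MvPolynomial.restrictSupport_eq_span, Set.image_iUnion, Submodule.span_iUnion]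

theorem disjoint_restrictSupport {σ K : Type*} [Field K] {s t : Set (σ →₀ ℕ)} :
    Disjoint (MvPolynomial.restrictSupport K s) (MvPolynomial.restrictSupport K t) ↔
      Disjoint s t := by
  constructor
  · intro h
    rw [Set.disjoint_left]
    intro a has hat
    have : MvPolynomial.monomial a (1 : K) = 0 := Submodule.disjoint_def.1 h _
      ((MvPolynomial.monomial_mem_restrictSupport _).2 (Or.inl has))
      ((MvPolynomial.monomial_mem_restrictSupport _).2 (Or.inl hat))
    simp at this
  · intro h
    rw [Submodule.disjoint_def]
    intro p hs ht
    rw [MvPolynomial.mem_restrictSupport_iff] at hs ht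
    rw [← MvPolynomial.support_eq_empty, Finset.eq_empty_iff_forall_notMem]
    exact fun a ha => Set.disjoint_left.1 h (hs ha) (ht ha)

theorem restrictSupport_injective {σ K : Type*} [Field K] :
    Function.Injective (MvPolynomial.restrictSupport (σ := σ) K) := by
  intro s t h
  ext a
  have := SetLike.ext_iff.1 h (MvPolynomial.monomial a (1 : K))
  simpa [MvPolynomial.monomial_mem_restrictSupport] using this

theorem iSupIndep_restrictSupport {σ K ι : Type*} [Field K] (s : ι → Set (σ →₀ ℕ)) :
    (iSupIndep fun i => MvPolynomial.restrictSupport K (s i)) ↔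
      Pairwise fun i j => Disjoint (s i) (s j) := by
  constructor
  · exact fun h i j hij => disjoint_restrictSupport.1 (h.pairwiseDisjoint hij)
  · intro h i
    have hsup : ⨆ j, ⨆ (_ : j ≠ i), MvPolynomial.restrictSupport K (s j) =
        MvPolynomial.restrictSupport K (⋃ j, ⋃ (_ : j ≠ i), s j) := by
      simp only [restrictSupport_iUnion]
    rw [hsup, disjoint_restrictSupport]
    simpa [Set.disjoint_iUnion_right] using fun j hj => h (Ne.symm hj)

theorem restrictScalars_monomialSpan {n : ℕ} {K : Type*} [Field K] (G : Finset (Fin n →₀ ℕ)) :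
    (monomialSpan K (G : Set (Fin n →₀ ℕ))).restrictScalars K =
      MvPolynomial.restrictSupport K (upperExponents G) := by
  ext p
  rw [Submodule.restrictScalars_mem, mem_monomialSpan, MvPolynomial.mem_restrictSupport_iff]
  rfl

/-- `U` is a finite disjoint union of cones of dimension at least `d`. -/
def IsDisjointUnionOfCones {n : ℕ} (d : ℕ) (U : Set (Fin n →₀ ℕ)) : Prop :=
  ∃ (ι : Type) (_ : Finite ι) (u : ι → Fin n →₀ ℕ) (Z : ι → Finset (Fin n)),
    (∀ i, d ≤ (Z i).card) ∧ (Pairwise fun i j =>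
      Disjoint (exponentCone (u i) (Z i)) (exponentCone (u j) (Z j))) ∧
    ⋃ i, exponentCone (u i) (Z i) = U

/-- A partition of the exponents of a monomial ideal into cones yields a Stanley decomposition. -/
theorem le_stanleyDepth_monomialSpan {n d : ℕ} {K : Type*} [Field K] {G : Finset (Fin n →₀ ℕ)}
    (h : IsDisjointUnionOfCones d (upperExponents G)) :
    (d : ℕ∞) ≤ stanleyDepth (monomialSpan K (G : Set (Fin n →₀ ℕ))) := by
  obtain ⟨ι, _, u, Z, hd, hdisj, hU⟩ := h
  let e := Finite.equivFin ι
  let D : StanleyDecomposition (monomialSpan K (G : Set (Fin n →₀ ℕ))) :=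
    { r := Nat.card ι
      u := fun i => MvPolynomial.monomial (u (e.symm i)) 1
      Z := fun i => Z (e.symm i)
      u_mem := fun i => (monomial_mem_monomialSpan one_ne_zero).2
        (hU.subset (Set.mem_iUnion_of_mem _ (self_mem_exponentCone _ _)))
      u_homogeneous := fun i => ⟨_, 1, one_ne_zero, rfl⟩
      independent := by
        simp_rw [stanleySpace_monomial _ (one_ne_zero : (1 : K) ≠ 0)]
        rw [iSupIndep_restrictSupport]
        exact fun i j hij => hdisj (e.symm.injective.ne hij)
      iSup_eq := by
        simp_rw [stanleySpace_monomial _ (one_ne_zero : (1 : K) ≠ 0)]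
        rw [← restrictSupport_iUnion, restrictScalars_monomialSpan, ← hU]
        congr 1
        exact e.symm.surjective.iUnion_comp fun i => exponentCone (u i) (Z i) }
  refine le_trans ?_ (le_iSup _ D)
  exact le_iInf fun i => Nat.cast_le.2 (hd _)

/-- The exponents of the spaces of a Stanley decomposition partition those of the ideal. -/
theorem StanleyDecomposition.exists_exponentCone {n : ℕ} {K : Type*} [Field K]
    {G : Finset (Fin n →₀ ℕ)}
    (D : StanleyDecomposition (monomialSpan K (G : Set (Fin n →₀ ℕ)))) :
    ∃ u : Fin D.r → Fin n →₀ ℕ, (Pairwise fun i j =>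
      Disjoint (exponentCone (u i) (D.Z i)) (exponentCone (u j) (D.Z j))) ∧
      ⋃ i, exponentCone (u i) (D.Z i) = upperExponents G := by
  choose u c hc hu using D.u_homogeneous
  have hspace : (fun i => stanleySpace (D.u i) (D.Z i)) =
      fun i => MvPolynomial.restrictSupport K (exponentCone (u i) (D.Z i)) :=
    funext fun i => by rw [hu, stanleySpace_monomial _ (hc i)]
  refine ⟨u, (iSupIndep_restrictSupport (K := K) _).1 (hspace ▸ D.independent),
    restrictSupport_injective (K := K) ?_⟩
  rw [restrictSupport_iUnion, ← restrictScalars_monomialSpan, ← D.iSup_eq]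
  exact congrArg iSup hspace.symm

/-! ### Cutting cones by non-divisibility conditions -/

theorem isDisjointUnionOfCones_exponentCone {n d : ℕ} (u : Fin n →₀ ℕ) {Z : Finset (Fin n)}
    (hd : d ≤ Z.card) : IsDisjointUnionOfCones d (exponentCone u Z) :=
  ⟨Unit, inferInstance, fun _ => u, fun _ => Z, fun _ => hd,
    fun _ _ h => (h rfl).elim, Set.iUnion_const _⟩

theorem IsDisjointUnionOfCones.mono {n d d' : ℕ} {U : Set (Fin n →₀ ℕ)} (hd : d' ≤ d)
    (h : IsDisjointUnionOfCones d U) : IsDisjointUnionOfCones d' U := by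
  obtain ⟨ι, hι, u, Z, hZ, h⟩ := h
  exact ⟨ι, hι, u, Z, fun i => hd.trans (hZ i), h⟩

theorem isDisjointUnionOfCones_empty {n d : ℕ} :
    IsDisjointUnionOfCones d (∅ : Set (Fin n →₀ ℕ)) :=
  ⟨Empty, inferInstance, Empty.elim, Empty.elim, fun i => i.elim, fun i => i.elim, by simp⟩

theorem IsDisjointUnionOfCones.iUnion {n d : ℕ} {J : Type} [Finite J]
    {U : J → Set (Fin n →₀ ℕ)} (hU : ∀ j, IsDisjointUnionOfCones d (U j))
    (hdisj : Pairwise fun i j => Disjoint (U i) (U j)) :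
    IsDisjointUnionOfCones d (⋃ j, U j) := by
  choose ι hι u Z hd hp hU using hU
  refine ⟨Σ j, ι j, inferInstance, fun p => u p.1 p.2, fun p => Z p.1 p.2, fun p => hd _ _, ?_, ?_⟩
  · rintro ⟨i, a⟩ ⟨j, b⟩ hne
    by_cases hij : i = j
    · subst hij
      exact hp i fun hab => hne (congrArg (Sigma.mk i) hab)
    · refine (hdisj hij).mono ?_ ?_
      · rw [← hU i]; exact Set.subset_iUnion_of_subset a subset_rfl
      · rw [← hU j]; exact Set.subset_iUnion_of_subset b subset_rfl
  · rw [Set.iUnion_sigma]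
    exact Set.iUnion_congr hU

/-- The exponents in a cone that dominate none of a family of exponents with disjoint supports
in free directions of the cone form a disjoint union of cones, where each member of the family
costs one dimension: the exponents `a` not dominating `g` are sorted according to the first
coordinate `t` with `a t < g t` and the value `a t`. -/
theorem isDisjointUnionOfCones_not_le {n : ℕ} (C : Finset (Fin n →₀ ℕ)) (u : Fin n →₀ ℕ)
    (Z : Finset (Fin n)) (hdis : ∀ g ∈ C, ∀ h ∈ C, g ≠ h → Disjoint g.support h.support)
    (hZ : ∀ g ∈ C, g.support ⊆ Z) (hu : ∀ g ∈ C, ∀ i ∈ g.support, u i = 0) :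
    IsDisjointUnionOfCones (Z.card - C.card) {a | a ∈ exponentCone u Z ∧ ∀ g ∈ C, ¬ g ≤ a} := by
  classical
  induction C using Finset.induction_on generalizing u Z with
  | empty => simpa using isDisjointUnionOfCones_exponentCone u le_rfl
  | insert g C hgC ih =>
    -- the vertex of the part where `t` is the first coordinate below `g` and has the value `c`
    let v : (Σ t : Fin n, Fin (g t)) → Fin n →₀ ℕ := fun p => Finsupp.equivFunOnFinite.symm
      fun s => if s < p.1 then max (u s) (g s) else if s = p.1 then p.2 else u s
    have hv : ∀ p s, v p s = if s < p.1 then max (u s) (g s) else if s = p.1 then p.2 else u s :=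
      fun _ _ => rfl
    have hsupp : ∀ t (c : Fin (g t)), t ∈ g.support := fun t c =>
      Finsupp.mem_support_iff.2 (by have := c.2; omega)
    have hgu : ∀ t ∈ g.support, u t = 0 := hu g (Finset.mem_insert_self _ _)
    have hgZ : g.support ⊆ Z := hZ g (Finset.mem_insert_self _ _)
    have hgC' : ∀ h ∈ C, ∀ i ∈ h.support, g i = 0 := fun h hh i hi => by
      by_contra hgi
      exact Finset.disjoint_left.1 (hdis g (Finset.mem_insert_self _ _) h
        (Finset.mem_insert_of_mem hh) fun e => hgC (e ▸ hh)) (Finsupp.mem_support_iff.2 hgi) hi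
    have key : {a | a ∈ exponentCone u Z ∧ ∀ h ∈ insert g C, ¬ h ≤ a} =
        ⋃ p : Σ t : Fin n, Fin (g t),
          {a | a ∈ exponentCone (v p) (Z.erase p.1) ∧ ∀ h ∈ C, ¬ h ≤ a} := by
      ext a
      simp only [Set.mem_iUnion, Set.mem_ofPred_eq, Finset.forall_mem_insert]
      constructor
      · rintro ⟨⟨hua, haZ⟩, hga, hCa⟩
        have hex : ∃ t, a t < g t := by
          by_contra! hcon
          exact hga hcon
        obtain ⟨t, ht, hmin⟩ : ∃ t, a t < g t ∧ ∀ s < t, g s ≤ a s := by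
          have hne : (Finset.univ.filter fun t => a t < g t).Nonempty := by
            obtain ⟨t, ht⟩ := hex
            exact ⟨t, by simpa using ht⟩
          refine ⟨_, (Finset.mem_filter.1 (Finset.min'_mem _ hne)).2, fun s hs => ?_⟩
          by_contra! hlt
          exact absurd (Finset.min'_le _ s (by simpa using hlt)) (not_le.2 hs)
        refine ⟨⟨t, a t, ht⟩, ⟨fun s => ?_, fun s hs => ?_⟩, hCa⟩
        · rw [hv]
          have := hua s
          split_ifs with h1 h2
          · exact max_le this (hmin s h1)
          · simp [h2]
          · exact this
        · rw [hv]
          rcases eq_or_ne s t with rfl | hst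
          · simp
          · have hsZ : s ∉ Z := fun h => hs (Finset.mem_erase.2 ⟨hst, h⟩)
            have hgs : g s = 0 := by
              by_contra h0
              exact hsZ (hgZ (Finsupp.mem_support_iff.2 h0))
            simp [hst, hgs, haZ s hsZ]
      · rintro ⟨⟨t, c⟩, ⟨hva, haZ⟩, hCa⟩
        have hat : a t = c := by
          have := haZ t (by simp)
          rw [hv] at this
          simpa using this
        refine ⟨⟨fun s => ?_, fun s hs => ?_⟩, fun hga => ?_, hCa⟩
        · have h := hva s
          rw [hv] at h
          split_ifs at h with h1 h2
          · exact (le_max_left _ _).trans h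
          · subst h2
            rw [hgu _ (hsupp _ c)]
            exact Nat.zero_le _
          · exact h
        · have hst : s ≠ t := fun e => hs (e ▸ hgZ (hsupp t c))
          have hgs : g s = 0 := by
            by_contra h0
            exact hs (hgZ (Finsupp.mem_support_iff.2 h0))
          have := haZ s (fun h => hs (Finset.mem_of_mem_erase h))
          rw [hv] at this
          simpa [hst, hgs] using this
        · have := hga t
          have := c.2
          omega
    rw [key]
    refine IsDisjointUnionOfCones.iUnion (fun p => ?_) ?_
    · have h := ih (v p) (Z.erase p.1)
        (fun g hg h hh => hdis g (Finset.mem_insert_of_mem hg) h (Finset.mem_insert_of_mem hh))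
        (fun h hh i hi => Finset.mem_erase.2 ⟨?_, hZ h (Finset.mem_insert_of_mem hh) hi⟩)
        (fun h hh i hi => ?_)
      · rw [Finset.card_insert_of_notMem hgC]
        rwa [Finset.card_erase_of_mem (hgZ (hsupp p.1 p.2)), Nat.sub_sub, Nat.add_comm] at h
      · rintro rfl
        exact Finsupp.mem_support_iff.1 (hsupp p.1 p.2) (hgC' h hh _ hi)
      · have hip : i ≠ p.1 := by
          rintro rfl
          exact Finsupp.mem_support_iff.1 (hsupp p.1 p.2) (hgC' h hh _ hi)
        rw [hv]
        simp [hip, hgC' h hh i hi, hu h (Finset.mem_insert_of_mem hh) i hi]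
    · rintro ⟨t, c⟩ ⟨t', c'⟩ hne
      -- a common element fails to dominate `g` first at `t` and first at `t'`, with both values
      rw [Set.disjoint_left]
      rintro a ⟨⟨ha, haZ⟩, -⟩ ⟨⟨ha', haZ'⟩, -⟩
      have hat : a t = c := by
        have := haZ t (by simp)
        rw [hv] at this
        simpa using this
      have hat' : a t' = c' := by
        have := haZ' t' (by simp)
        rw [hv] at this
        simpa using this
      have hc := c.2
      have hc' := c'.2
      rcases lt_trichotomy t t' with h | h | h
      · have := ha' t
        rw [hv, if_pos h] at this
        have := (le_max_right _ _).trans this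
        omega
      · subst h
        exact hne (by rw [Fin.ext (hat.symm.trans hat')])
      · have := ha t'
        rw [hv, if_pos h] at this
        have := (le_max_right _ _).trans this
        omega

/-! ### The lower bound -/

/-- The exponents are sorted according to the even hull of the set of generators dividing the
monomial, where the generators are placed on a cycle of odd length `2 * (m / 2) + 1`. -/
theorem isDisjointUnionOfCones_upperExponents {n : ℕ} (G : Finset (Fin n →₀ ℕ))
    (hdis : ∀ g ∈ G, ∀ h ∈ G, g ≠ h → Disjoint g.support h.support) :
    IsDisjointUnionOfCones (n - G.card / 2) (upperExponents G) := by
  classical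
  obtain ⟨f⟩ : Nonempty (G ↪ ZMod (2 * (G.card / 2) + 1)) :=
    Function.Embedding.nonempty_of_card_le (by
      rw [Fintype.card_coe, ZMod.card]
      omega)
  have hodd : Odd (2 * (G.card / 2) + 1) := ⟨_, rfl⟩
  let T : (Fin n →₀ ℕ) → Finset (ZMod (2 * (G.card / 2) + 1)) := fun a =>
    (Finset.univ.filter fun g : G => (g : Fin n →₀ ℕ) ≤ a).map f
  have hT : ∀ a (g : G), f g ∈ T a ↔ (g : Fin n →₀ ℕ) ≤ a := by simp [T]
  have hTf : ∀ a x, x ∈ T a → ∃ g, f g = x := by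
    intro a x hx
    obtain ⟨g, -, hg⟩ := Finset.mem_map.1 hx
    exact ⟨g, hg⟩
  have hTne : ∀ a, a ∈ upperExponents G ↔ (T a).Nonempty := by
    intro a
    constructor
    · rintro ⟨g, hg, hga⟩
      exact ⟨f ⟨g, hg⟩, (hT a _).2 hga⟩
    · rintro ⟨x, hx⟩
      obtain ⟨g, rfl⟩ := hTf a x hx
      exact ⟨g, g.2, (hT a g).1 hx⟩
  have hne : ∀ a E, IsEvenHull (T a) E → (T a).Nonempty := by
    intro a E hE
    rw [Finset.nonempty_iff_ne_empty]
    intro h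
    rw [h] at hE
    exact not_isEvenHull_empty hodd E hE
  have hU : upperExponents G = ⋃ E, {a | IsEvenHull (T a) E} := by
    ext a
    rw [Set.mem_iUnion, hTne]
    exact ⟨fun h => exists_isEvenHull h, fun ⟨E, hE⟩ => hne a E hE⟩
  rw [hU]
  refine IsDisjointUnionOfCones.iUnion (fun E => ?_) fun E F hEF =>
    Set.disjoint_left.2 fun a hE hF => hEF (IsEvenHull.unique (hne a E hE) hE hF)
  rcases Set.eq_empty_or_nonempty {a | IsEvenHull (T a) E} with hempty | ⟨b, hb⟩
  · rw [hempty]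
    exact isDisjointUnionOfCones_empty
  -- the generators that have to divide the monomial, and those that must not
  let A : Finset (Fin n →₀ ℕ) := (Finset.univ.filter fun g : G => f g ∈ E ∧ f g - 1 ∈ E).map
    (Function.Embedding.subtype _)
  let C : Finset (Fin n →₀ ℕ) := (Finset.univ.filter fun g : G => f g ∉ E).map
    (Function.Embedding.subtype _)
  have hA : ∀ g, g ∈ A ↔ ∃ hg : g ∈ G, f ⟨g, hg⟩ ∈ E ∧ f ⟨g, hg⟩ - 1 ∈ E := by simp [A]
  have hC : ∀ g, g ∈ C ↔ ∃ hg : g ∈ G, f ⟨g, hg⟩ ∉ E := by simp [C]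
  have hCcard : C.card ≤ G.card / 2 := by
    have h1 : C.card ≤ Eᶜ.card := by
      rw [Finset.card_map]
      exact Finset.card_le_card_of_injOn f (fun g hg => by simpa using hg) f.injective.injOn
    have h2 := IsEvenHull.two_mul_card_compl_le hb
    omega
  have hpiece : {a | IsEvenHull (T a) E} =
      {a | a ∈ exponentCone (A.sup id) Finset.univ ∧ ∀ g ∈ C, ¬ g ≤ a} := by
    ext a
    have hb' := isEvenHull_iff.1 hb
    simp only [Set.mem_ofPred_eq, exponentCone, isEvenHull_iff, Finset.sup_le_iff, id, hA, hC]
    constructor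
    · rintro ⟨-, h1, h2⟩
      refine ⟨⟨?_, by simp⟩, ?_⟩
      · rintro g ⟨hg, hgE, hgE'⟩
        exact (hT a ⟨g, hg⟩).1 (h1 _ hgE hgE')
      · rintro g ⟨hg, hgE⟩ hga
        exact h2 _ hgE ((hT a ⟨g, hg⟩).2 hga)
    · rintro ⟨⟨h1, -⟩, h2⟩
      refine ⟨hb'.1, fun x hx hx' => ?_, fun x hx hxa => ?_⟩
      · obtain ⟨g, rfl⟩ := hTf b x (hb'.2.1 x hx hx')
        exact (hT a g).2 (h1 g ⟨g.2, hx, hx'⟩)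
      · obtain ⟨g, rfl⟩ := hTf a x hxa
        exact h2 g ⟨g.2, hx⟩ ((hT a g).1 hxa)
  rw [hpiece]
  have hCG : ∀ g ∈ C, g ∈ G := fun g hg => ((hC g).1 hg).1
  refine (isDisjointUnionOfCones_not_le C (A.sup id) Finset.univ
    (fun g hg h hh => hdis g (hCG g hg) h (hCG h hh)) (fun _ _ => Finset.subset_univ _)
    fun g hg i hi => ?_).mono ?_
  · refine Finset.sup_induction (p := fun u : Fin n →₀ ℕ => u i = 0) rfl ?_ ?_
    · intro u hu v hv
      simp [Finsupp.sup_apply, hu, hv]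
    · intro h hh
      obtain ⟨hhG, hhE, -⟩ := (hA h).1 hh
      obtain ⟨hgG, hgE⟩ := (hC g).1 hg
      by_contra hhi
      refine Finset.disjoint_left.1 (hdis g hgG h hhG ?_) hi (Finsupp.mem_support_iff.2 hhi)
      rintro rfl
      exact hgE hhE
  · rw [Finset.card_univ, Fintype.card_fin]
    omega

/-! ### The upper bound -/

/-- In a Stanley decomposition each generator `g` is the vertex of a cone. For two generators
`g ≠ h`, the exponent `g + h` lies in only one cone, so that it is impossible that `h` is supported
on the free directions of the cone at `g` and also `g` on those of the cone at `h`. Counting pairs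
bounds the smallest dimension. -/
theorem StanleyDecomposition.exists_card_le {n : ℕ} {K : Type*} [Field K]
    {G : Finset (Fin n →₀ ℕ)} (hG : G.Nonempty)
    (hanti : ∀ g ∈ G, ∀ h ∈ G, g ≤ h → g = h)
    (hdis : ∀ g ∈ G, ∀ h ∈ G, g ≠ h → Disjoint g.support h.support)
    (D : StanleyDecomposition (monomialSpan K (G : Set (Fin n →₀ ℕ)))) :
    ∃ i, (D.Z i).card ≤ n - G.card / 2 := by
  classical
  by_contra! hbig
  obtain ⟨u, hdisj, hU⟩ := D.exists_exponentCone
  have hvertex : ∀ g : G, ∃ i, u i = g := by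
    intro g
    have hg : (g : Fin n →₀ ℕ) ∈ ⋃ i, exponentCone (u i) (D.Z i) :=
      hU.superset ⟨g, g.2, le_rfl⟩
    obtain ⟨i, hi⟩ := Set.mem_iUnion.1 hg
    obtain ⟨h, hh, hhu⟩ : u i ∈ upperExponents G :=
      hU.subset (Set.mem_iUnion_of_mem i (self_mem_exponentCone _ _))
    refine ⟨i, le_antisymm hi.1 ?_⟩
    rw [← hanti h hh g g.2 (hhu.trans hi.1)]
    exact hhu
  choose i hi using hvertex
  let P : G → G → Prop := fun g h => h ≠ g ∧ (h : Fin n →₀ ℕ).support ⊆ D.Z (i g)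
  have hmem : ∀ g h, P g h → (g + h : Fin n →₀ ℕ) ∈ exponentCone (u (i g)) (D.Z (i g)) := by
    intro g h hgh
    rw [hi]
    refine ⟨le_self_add, fun t ht => ?_⟩
    have : (h : Fin n →₀ ℕ) t = 0 := by
      by_contra h0
      exact ht (hgh.2 (Finsupp.mem_support_iff.2 h0))
    rw [Finsupp.add_apply, this, add_zero]
  have hasymm : ∀ g h, P g h → ¬ P h g := by
    intro g h hgh hhg
    have hne : i g ≠ i h := fun e => hgh.1 (Subtype.ext (by rw [← hi, ← hi, e]))
    exact Set.disjoint_left.1 (hdisj hne) (hmem g h hgh)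
      (add_comm (g : Fin n →₀ ℕ) h ▸ hmem h g hhg)
  -- since the supports are disjoint, each missing direction spoils at most one generator
  have hcount : ∀ g, G.card ≤ G.card / 2 + ∑ h, if P g h then 1 else 0 := by
    intro g
    have h1 : (Finset.univ.filter fun h : G => ¬ (h : Fin n →₀ ℕ).support ⊆ D.Z (i g)).card ≤
        (D.Z (i g))ᶜ.card := by
      have hex : ∀ h : G, ¬ (h : Fin n →₀ ℕ).support ⊆ D.Z (i g) →
          ∃ t, t ∈ (h : Fin n →₀ ℕ).support ∧ t ∉ D.Z (i g) :=
        fun h hh => Finset.not_subset.1 hh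
      have : Nonempty (Fin n) :=
        ⟨(Finset.card_pos.1 ((Nat.zero_le _).trans_lt (hbig (i g)))).choose⟩
      choose! t ht using hex
      refine Finset.card_le_card_of_injOn t (fun h hh => ?_) fun h hh h' hh' e => ?_
      · simpa using (ht h (by simpa using hh)).2
      · by_contra hne
        refine Finset.disjoint_left.1 (hdis h h.2 h' h'.2 fun e => hne (Subtype.ext e))
          (ht h (by simpa using hh)).1 ?_
        rw [e]
        exact (ht h' (by simpa using hh')).1
    have h2 : (Finset.univ : Finset G) ⊆ insert g
        ((Finset.univ.filter fun h : G => ¬ (h : Fin n →₀ ℕ).support ⊆ D.Z (i g)) ∪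
          Finset.univ.filter fun h => P g h) := by
      intro h _
      simp only [Finset.mem_insert, Finset.mem_union, Finset.mem_filter, Finset.mem_univ,
        true_and, P]
      tauto
    have h3 := (Finset.card_le_card h2).trans
      ((Finset.card_insert_le _ _).trans (Nat.succ_le_succ (Finset.card_union_le _ _)))
    rw [Finset.card_univ, Fintype.card_coe] at h3
    rw [Finset.card_compl, Fintype.card_fin] at h1
    rw [← Finset.card_filter]
    have := hbig (i g)
    have := (D.Z (i g)).card_le_univ
    rw [Fintype.card_fin] at this
    omega
  have hpairs : (∑ g, ∑ h, if P g h then 1 else 0) + (∑ g, ∑ h, if P g h then 1 else 0) ≤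
      G.card * (G.card - 1) := by
    nth_rewrite 2 [Finset.sum_comm]
    rw [← Finset.sum_add_distrib]
    have : ∀ g : G, (∑ h, if P g h then 1 else 0) + (∑ h, if P h g then 1 else 0) ≤
        G.card - 1 := by
      intro g
      rw [← Finset.sum_add_distrib, ← Fintype.card_coe, ← Finset.card_univ,
        ← Finset.card_erase_of_mem (Finset.mem_univ g), Finset.card_eq_sum_ones,
        ← Finset.add_sum_erase _ _ (Finset.mem_univ g)]
      have hg : ¬ P g g := fun h => h.1 rfl
      rw [if_neg hg, zero_add, zero_add]
      refine Finset.sum_le_sum fun h _ => ?_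
      have := hasymm g h
      split_ifs <;> simp_all
    simpa using Finset.sum_le_sum fun g (_ : g ∈ (Finset.univ : Finset G)) => this g
  have hsum := Finset.sum_le_sum fun g (_ : g ∈ (Finset.univ : Finset G)) => hcount g
  rw [Finset.sum_add_distrib] at hsum
  simp only [Finset.sum_const, Finset.card_univ, Fintype.card_coe, smul_eq_mul] at hsum
  have hpos := hG.card_pos
  have h1 : 2 * (G.card * (G.card / 2)) ≤ G.card * G.card := by
    rw [← mul_assoc, mul_comm 2, mul_assoc]
    exact Nat.mul_le_mul_left _ (by omega)
  have h2 : G.card * (G.card - 1) < G.card * G.card := Nat.mul_lt_mul_of_pos_left (by omega) hpos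
  omega

/-! ### The Stanley depth of a complete intersection monomial ideal -/

/-- A nonzero complete intersection monomial ideal of `K[x₁, …, xₙ]` that is minimally generated
by `m` monomials has Stanley depth `n - ⌊m / 2⌋`. (Here `m ≤ n`, so nothing is truncated.) -/
theorem mainTheorem1 {K : Type*} [Field K] (n m : ℕ) (I : Ideal (MvPolynomial (Fin n) K))
    (hmon : IsMonomialIdeal I) (hci : IsCompleteIntersectionIdeal I) (hne : I ≠ ⊥)
    (hm : ∃ G : Finset (Fin n →₀ ℕ), IsMinimalMonomialGenerators I G ∧ G.card = m) :
    stanleyDepth I = ((n - m / 2 : ℕ) : ℕ∞) := by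
  obtain ⟨G, hG, rfl⟩ := hm
  have hdis : ∀ g ∈ G, ∀ h ∈ G, g ≠ h → Disjoint g.support h.support :=
    fun g hg h hh => hG.disjoint_support hci hg hh
  have hanti : ∀ g ∈ G, ∀ h ∈ G, g ≤ h → g = h := fun g hg h hh => hG.eq_of_le hg hh
  obtain rfl := hG.1
  have hGne : G.Nonempty := by
    rw [Finset.nonempty_iff_ne_empty]
    rintro rfl
    exact hne (by simp [monomialSpan])
  apply le_antisymm
  · refine iSup_le fun D => ?_
    obtain ⟨i, hi⟩ := D.exists_card_le hGne hanti hdis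
    exact (iInf_le _ i).trans (Nat.cast_le.2 hi)
  · exact le_stanleyDepth_monomialSpan (isDisjointUnionOfCones_upperExponents G hdis)
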